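/- There is an absolute constant $C>0$ with the following property. Let $A,B,N$ be integers with $1\le B\le A\le 2B\le N$. Then there are a finite connected planar graph $G$ (multiple edges and loops are allowed) with at most $C\,(\log N)\,(\log\log N)^2$ edges and a non-loop edge $e$ of $G$ such that $$\frac{\tau(G-e)}{\tau(G/e)}=\frac{A}{B}.$$ Here $\tau(H)$ is the number of spanning trees of a graph $H$, $G-e$ is obtained from $G$ by deleting $e$, and $G/e$ is obtained from $G$ by identifying the two ends of $e$ and removing the resulting loops. A graph is planar if it can be drawn in the plane without crossings. -/

import Mathlib

namespace Graph

variable {α β : Type*}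

/-- `G` is connected: it has a vertex, and any two of its vertices are joined by a walk. -/
def IsConnected (G : Graph α β) : Prop :=
  G.vertexSet.Nonempty ∧
    ∀ x ∈ G.vertexSet, ∀ y ∈ G.vertexSet, Relation.ReflTransGen G.Adj x y

/-- `G` has no cycle. A cycle of length `n ≥ 1` consists of distinct vertices `v 0, …, v (n - 1)`
and distinct edges `c 0, …, c (n - 1)`, where `c i` joins `v i` to `v (i + 1)` and `v n = v 0`.
So a loop is a cycle of length 1 and two parallel edges form a cycle of length 2. -/
def IsAcyclic (G : Graph α β) : Prop :=
  ¬ ∃ (n : ℕ) (v : ℕ → α) (c : ℕ → β), 1 ≤ n ∧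
    Set.InjOn v (Set.Iio n) ∧ Set.InjOn c (Set.Iio n) ∧
    (∀ i < n, G.IsLink (c i) (v i) (v (i + 1))) ∧ v n = v 0

/-- The edge set `F` forms a spanning tree of `G`: the spanning subgraph `(V(G), F)` is connected
and has no cycle. -/
def IsSpanningTree (G : Graph α β) (F : Set β) : Prop :=
  F ⊆ G.edgeSet ∧ (G.restrict F).IsConnected ∧ (G.restrict F).IsAcyclic

/-- The number `τ(G)` of spanning trees of a finite graph `G`. -/
noncomputable def numSpanningTrees (G : Graph α β) : ℕ :=
  {F : Set β | G.IsSpanningTree F}.ncard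

/-- The deletion `G - e`. -/
def deleteEdge (G : Graph α β) (e : β) : Graph α β := G.deleteEdges {e}

/-- The contraction `G / e`: the two ends of `e` are identified, and the edges which this turns
into loops (`e` itself and the edges parallel to it) are removed. -/
def contractEdge (G : Graph α β) (e : β) : Graph (Quot (G.IsLink e)) β :=
  (G.map (Quot.mk (G.IsLink e))).deleteEdges {f | ∃ x y, G.IsLink e x y ∧ G.IsLink f x y}

/-- The spanning tree ratio `ρ(G, e) = τ(G - e) / τ(G / e)`. (It is `0` if the denominator is `0`,
so a positive value is an actual quotient of positive integers.) -/
noncomputable def spanningTreeRatio (G : Graph α β) (e : β) : ℚ :=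
  ((G.deleteEdge e).numSpanningTrees : ℚ) / ((G.contractEdge e).numSpanningTrees : ℚ)

/-- A drawing of `G` in the plane without crossings: the vertices are distinct points, every edge
is a curve joining its two ends, and an interior point of an edge is not a vertex, is passed only
once by that edge, and lies on no other edge. (A loop is drawn as a simple closed curve.) -/
structure PlaneEmbedding (G : Graph α β) where
  point : α → ℝ × ℝ
  curve : β → ℝ → ℝ × ℝ
  point_injOn : Set.InjOn point G.vertexSet
  curve_continuousOn : ∀ e ∈ G.edgeSet, ContinuousOn (curve e) (Set.Icc 0 1)
  curve_ends : ∀ e ∈ G.edgeSet,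
    ∃ x y, G.IsLink e x y ∧ curve e 0 = point x ∧ curve e 1 = point y
  curve_ne_point : ∀ e ∈ G.edgeSet, ∀ t ∈ Set.Ioo (0 : ℝ) 1, ∀ x ∈ G.vertexSet,
    curve e t ≠ point x
  curve_inj : ∀ e ∈ G.edgeSet, ∀ f ∈ G.edgeSet, ∀ s ∈ Set.Ioo (0 : ℝ) 1,
    ∀ t ∈ Set.Ioo (0 : ℝ) 1, curve e s = curve f t → e = f ∧ s = t

/-- `G` is planar: it can be drawn in the plane without crossings. -/
def IsPlanar (G : Graph α β) : Prop := Nonempty G.PlaneEmbedding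

end Graph

/-! Fans realise continued fractions. Let `t` count the spanning trees of a fan and `f` its
two-component spanning forests that separate the apex from the last path vertex. A new spoke maps
`(t, f)` to `(t + f, f)`, a new path edge to `(t, t + f)`. Running Euclid's algorithm backwards thus
gives every `t / f = y / x` with at most as many edges as the sum of the partial quotients
(`exists_fanValue`). Placing two fans on the two sides of a marked spoke adds their values, as
conductances add in parallel (`spanningTreeRatio_fanOfLists`).

It remains to write `A / B` as `x / B + y / B + k` with `k ≤ 2` and small quotient sums. A quotient
`a` occurring at a convergent denominator `q` of `x / B` forces `q * x` or `-q * x` to have a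
positive residue at most `B / (q * a)` (`quotientSum_le_aux`), and for given `q` and `m` at most `B
/ (q * m)` residues `x` satisfy `0 < q * x mod B ≤ B / (q * m)`. So few `x` have a quotient above `M
≈ 8 * harmonic B`, and truncating at `M` makes the average quotient sum of order `log B * log log
B`. A union bound over `x`, `-x`, `a - x`, `-(a - x)` yields a good pair
(`exists_add_quotientSum_le`). The second factor `log log N` of the theorem is slack. -/

open Relation

namespace Graph

/-! ### Spanning trees under deletion and contraction -/

section SpanningTree

variable {α β : Type*} {G : Graph α β} {F F' : Set β} {e f : β} {x y z : α}

/-- `x` and `y` are joined by an edge of `G` that belongs to `F`. -/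
def AdjIn (G : Graph α β) (F : Set β) (x y : α) : Prop := ∃ f ∈ F, G.IsLink f x y

/-- Any two vertices of `G` are joined by a walk with edges in `F`. -/
def Connects (G : Graph α β) (F : Set β) : Prop :=
  ∀ x ∈ G.vertexSet, ∀ y ∈ G.vertexSet, ReflTransGen (G.AdjIn F) x y

lemma restrict_adj : (G.restrict F).Adj = G.AdjIn F := by
  ext x y
  simp [Adj, AdjIn, restrict]

lemma isConnected_restrict :
    (G.restrict F).IsConnected ↔ G.vertexSet.Nonempty ∧ G.Connects F := by
  rw [IsConnected, restrict_adj]; rfl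

lemma AdjIn.symm (h : G.AdjIn F x y) : G.AdjIn F y x := by
  obtain ⟨f, hf, h⟩ := h
  exact ⟨f, hf, h.symm⟩

lemma AdjIn.mono (hF : F ⊆ F') (h : G.AdjIn F x y) : G.AdjIn F' x y := by
  obtain ⟨f, hf, h⟩ := h
  exact ⟨f, hF hf, h⟩

lemma reach_symm (h : ReflTransGen (G.AdjIn F) x y) : ReflTransGen (G.AdjIn F) y x := by
  induction h with
  | refl => rfl
  | tail _ h ih => exact .head h.symm ih

lemma reach_mono (hF : F ⊆ F') (h : ReflTransGen (G.AdjIn F) x y) :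
    ReflTransGen (G.AdjIn F') x y :=
  ReflTransGen.mono (fun _ _ h ↦ h.mono hF) _ _ h

lemma Connects.mono (hF : F ⊆ F') (h : G.Connects F) : G.Connects F' :=
  fun x hx y hy ↦ reach_mono hF (h x hx y hy)

lemma reach_of_forall
    (hl : ∀ f ∈ F, ∀ x y, G.IsLink f x y → ReflTransGen (G.AdjIn F') x y)
    (h : ReflTransGen (G.AdjIn F) x y) : ReflTransGen (G.AdjIn F') x y := by
  induction h with
  | refl => rfl
  | tail _ h ih =>
    obtain ⟨f, hf, h⟩ := h
    exact ih.trans (hl f hf _ _ h)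

lemma Connects.of_forall (h : G.Connects F)
    (hl : ∀ f ∈ F, ∀ x y, G.IsLink f x y → ReflTransGen (G.AdjIn F') x y) : G.Connects F' :=
  fun x hx y hy ↦ reach_of_forall hl (h x hx y hy)

lemma Connects.replace (h : G.Connects F) (hl : G.IsLink f x y)
    (hr : ReflTransGen (G.AdjIn F') x y) (hF : F \ {f} ⊆ F') : G.Connects F' := by
  refine h.of_forall fun g hg u v huv ↦ ?_
  by_cases hgf : g = f
  · subst hgf
    obtain ⟨rfl, rfl⟩ | ⟨rfl, rfl⟩ := huv.eq_and_eq_or_eq_and_eq hl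
    · exact hr
    · exact reach_symm hr
  · exact .single ⟨g, hF ⟨hg, hgf⟩, huv⟩

/-- A walk that ends outside `x` either never meets `x` or can be started right after its last
visit to `x`. -/
lemma exists_walk_avoiding {r : α → α → Prop} {a : α} (h : ReflTransGen r a y) (hy : x ≠ y) :
    (a ≠ x ∧ ReflTransGen (fun p q ↦ r p q ∧ p ≠ x ∧ q ≠ x) a y) ∨
      ∃ z, r x z ∧ ReflTransGen (fun p q ↦ r p q ∧ p ≠ x ∧ q ≠ x) z y := by
  induction h using ReflTransGen.head_induction_on with
  | refl => exact .inl ⟨hy.symm, .refl⟩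
  | head hab _ ih =>
    rename_i a b _
    rcases ih with ⟨hb, ih⟩ | ih
    · by_cases ha : a = x
      · subst ha; exact .inr ⟨b, hab, ih⟩
      · exact .inl ⟨ha, .head ⟨hab, ha, hb⟩ ih⟩
    · exact .inr ih

/-- After its last visit to `x`, a walk from `x` to `y` leaves along some `f` and then avoids `x`.
Hence `e` followed by the rest of that walk, reversed, bypasses `f`. -/
lemma Connects.exists_exchange (h : G.Connects F) (hxy : x ≠ y) (hl : G.IsLink e x y)
    (he : e ∉ F) : ∃ f ∈ F, G.Connects (insert e F \ {f}) := by
  have key : ∃ z, G.AdjIn F x z ∧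
      ReflTransGen (fun p q ↦ G.AdjIn F p q ∧ p ≠ x ∧ q ≠ x) z y := by
    rcases exists_walk_avoiding (h x hl.left_mem y hl.right_mem) hxy with h | h
    · exact absurd rfl h.1
    · exact h
  obtain ⟨z, ⟨f, hf, hxz⟩, hzy⟩ := key
  refine ⟨f, hf, h.replace hxz ?_ (Set.sdiff_subset_sdiff_left (Set.subset_insert _ _))⟩
  have hef : e ≠ f := fun h ↦ he (h ▸ hf)
  refine .head ⟨e, ⟨Set.mem_insert _ _, hef⟩, hl⟩ (reach_symm (ReflTransGen.mono ?_ _ _ hzy))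
  rintro p q ⟨⟨g, hg, hpq⟩, hp, hq⟩
  refine ⟨g, ⟨.inr hg, ?_⟩, hpq⟩
  rintro rfl
  rcases hxz.left_eq_or_eq hpq with h | h
  · exact hp h.symm
  · exact hq h.symm

/-- A path between the ends of `f` that bypasses `f` closes up with `f` to a cycle. For a loop the
path has length 0. -/
lemma IsAcyclic.not_connects (hF : F ⊆ G.edgeSet) (h : (G.restrict F).IsAcyclic) (hf : f ∈ F) :
    ¬ G.Connects (F \ {f}) := by
  classical
  intro hc
  apply h
  obtain ⟨x, y, hxy⟩ := G.exists_isLink_of_mem_edgeSet (hF hf)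
  let S : SimpleGraph α := SimpleGraph.fromRel (G.AdjIn (F \ {f}))
  have hS : ∀ {u v}, S.Adj u v → G.AdjIn (F \ {f}) u v := by
    intro u v huv
    rcases huv.2 with h | h
    · exact h
    · exact h.symm
  have hr : S.Reachable x y := by
    have := hc x hxy.left_mem y hxy.right_mem
    clear hxy
    induction this with
    | refl => exact .refl _
    | tail _ h ih =>
      rename_i b c _
      by_cases hbc : b = c
      · exact hbc ▸ ih
      · exact ih.trans (SimpleGraph.Adj.reachable ⟨hbc, .inl h⟩)
  obtain ⟨p, hp⟩ := hr.exists_isPath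
  have hadj : ∀ i < p.length, ∃ g ∈ F \ {f}, G.IsLink g (p.getVert i) (p.getVert (i + 1)) :=
    fun i hi ↦ hS (p.adj_getVert_succ hi)
  have : Nonempty β := ⟨f⟩
  choose! c hcF hcl using hadj
  have hinj := hp.getVert_injOn
  have hlast := p.getVert_length
  have hfirst := p.getVert_zero
  -- The value `x` beyond the path occurs only at index `p.length + 1`, where it closes the cycle.
  refine ⟨p.length + 1, fun i ↦ if i ≤ p.length then p.getVert i else x,
    fun i ↦ if i < p.length then c i else f, by omega, ?_, ?_, ?_, ?_⟩
  · intro i hi j hj hij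
    simp only [Set.mem_Iio, Nat.lt_succ_iff] at hi hj
    simp only [hi, hj, if_true] at hij
    exact hinj hi hj hij
  · intro i hi j hj hij
    simp only [Set.mem_Iio, Nat.lt_succ_iff] at hi hj
    dsimp only at hij
    split_ifs at hij with h1 h2 h2
    · have hi' := hcl i h1
      have hj' := hcl j h2
      rw [hij] at hi'
      rcases hi'.eq_and_eq_or_eq_and_eq hj' with ⟨h, -⟩ | ⟨h, h'⟩
      · exact hinj hi hj h
      · have a := hinj hi (by simp; omega) h
        have b := hinj (by simp; omega) hj h'
        omega
    · exact absurd hij (hcF i h1).2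
    · exact absurd hij.symm (hcF j h2).2
    · omega
  · intro i hi
    simp only [restrict, Nat.lt_succ_iff] at hi ⊢
    rcases hi.lt_or_eq with h | rfl
    · rw [if_pos h, if_pos hi, if_pos (by omega)]
      simp [(hcF i h).1, hcl i h]
    · rw [if_neg (by omega), if_pos le_rfl, if_neg (by omega), hlast]
      simp [hf, hxy.symm]
  · simp

lemma isAcyclic_of_not_connects (hc : G.Connects F) (h : ∀ f ∈ F, ¬ G.Connects (F \ {f})) :
    (G.restrict F).IsAcyclic := by
  rintro ⟨n, v, c, hn, -, hci, hl, hv⟩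
  replace hl : ∀ i < n, c i ∈ F ∧ G.IsLink (c i) (v i) (v (i + 1)) := by
    simpa [restrict] using hl
  refine h (c 0) (hl 0 hn).1 (hc.replace (hl 0 hn).2 (reach_symm ?_) le_rfl)
  have key : ∀ k, k + 1 ≤ n → ReflTransGen (G.AdjIn (F \ {c 0})) (v 1) (v (k + 1)) := by
    intro k
    induction k with
    | zero => intro _; rfl
    | succ k ih =>
      intro hk
      refine (ih (by omega)).tail ⟨c (k + 1), ⟨(hl _ (by omega)).1, fun h ↦ ?_⟩, (hl _ (by omega)).2⟩
      have := hci (by simp; omega) (by simp; omega) (Set.mem_singleton_iff.1 h)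
      omega
  have := key (n - 1) (by omega)
  rwa [Nat.sub_add_cancel hn, hv] at this

/-- Spanning trees are the minimal connecting sets of edges. -/
lemma isSpanningTree_iff : G.IsSpanningTree F ↔
    F ⊆ G.edgeSet ∧ G.vertexSet.Nonempty ∧ G.Connects F ∧ ∀ f ∈ F, ¬ G.Connects (F \ {f}) := by
  rw [IsSpanningTree, isConnected_restrict]
  constructor
  · rintro ⟨h1, ⟨h2, h3⟩, h4⟩
    exact ⟨h1, h2, h3, fun f hf ↦ h4.not_connects h1 hf⟩
  · rintro ⟨h1, h2, h3, h4⟩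
    exact ⟨h1, ⟨h2, h3⟩, isAcyclic_of_not_connects h3 h4⟩

lemma connects_deleteEdge (he : e ∉ F) : (G.deleteEdge e).Connects F ↔ G.Connects F := by
  have : (G.deleteEdge e).AdjIn F = G.AdjIn F := by
    ext x y
    refine exists_congr fun f ↦ and_congr_right fun hf ↦ ?_
    have : f ≠ e := fun h ↦ he (h ▸ hf)
    simp [deleteEdge, this]
  rw [Connects, this]; rfl

lemma isSpanningTree_deleteEdge :
    (G.deleteEdge e).IsSpanningTree F ↔ G.IsSpanningTree F ∧ e ∉ F := by
  have hE : F ⊆ (G.deleteEdge e).edgeSet ↔ F ⊆ G.edgeSet ∧ e ∉ F := by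
    simp [deleteEdge, Set.subset_sdiff]
  have hV : (G.deleteEdge e).vertexSet = G.vertexSet := by simp [deleteEdge]
  simp only [isSpanningTree_iff, hE, hV]
  by_cases he : e ∈ F
  · simp [he]
  · simp only [he, connects_deleteEdge he, not_false_eq_true, and_true]
    exact and_congr_right fun _ ↦ and_congr_right fun _ ↦ and_congr_right fun _ ↦
      forall₂_congr fun f _ ↦ by rw [connects_deleteEdge fun h ↦ he h.1]

lemma reach_of_quot_eq (h : Quot.mk (G.IsLink e) x = Quot.mk (G.IsLink e) y) :
    ReflTransGen (G.AdjIn (insert e F)) x y := by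
  replace h := Quot.eqvGen_exact h
  induction h with
  | rel x y h => exact .single ⟨e, Set.mem_insert _ _, h⟩
  | refl x => rfl
  | symm x y _ ih => exact reach_symm ih
  | trans x y z _ _ h1 h2 => exact h1.trans h2

lemma connects_contractEdge (hF : F ⊆ (G.contractEdge e).edgeSet) :
    (G.contractEdge e).Connects F ↔ G.Connects (insert e F) := by
  constructor
  · intro h x hx y hy
    have := h (Quot.mk _ x) (by simpa [contractEdge] using ⟨x, hx, rfl⟩)
      (Quot.mk _ y) (by simpa [contractEdge] using ⟨y, hy, rfl⟩)
    generalize hb : Quot.mk (G.IsLink e) y = b at this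
    clear hy
    induction this generalizing y with
    | refl => exact reach_of_quot_eq hb.symm
    | tail _ h ih =>
      obtain ⟨f, hf, hl⟩ := h
      simp only [contractEdge, deleteEdges_isLink, map_isLink, Relation.Map] at hl
      obtain ⟨⟨u, v, huv, rfl, rfl⟩, -⟩ := hl
      exact ((ih u rfl).tail ⟨f, .inr hf, huv⟩).trans (reach_of_quot_eq hb.symm)
  · intro h a ha b hb
    have hV : (G.contractEdge e).vertexSet = Quot.mk (G.IsLink e) '' G.vertexSet := by
      simp [contractEdge]
    rw [hV] at ha hb
    obtain ⟨x, hx, rfl⟩ := ha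
    obtain ⟨y, hy, rfl⟩ := hb
    have := h x hx y hy
    clear hy
    induction this with
    | refl => rfl
    | tail _ h ih =>
      obtain ⟨f, hf, hl⟩ := h
      rename_i b c _
      rcases hf with rfl | hf
      · exact (Quot.sound hl : Quot.mk (G.IsLink f) b = _) ▸ ih
      · refine ih.tail ⟨f, hf, ?_⟩
        have := hF hf
        simp only [contractEdge, edgeSet_deleteEdges] at this
        simp only [contractEdge, deleteEdges_isLink]
        exact ⟨hl.map _, this.2⟩

lemma isSpanningTree_contractEdge (hxy : x ≠ y) (hl : G.IsLink e x y) :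
    (G.contractEdge e).IsSpanningTree F ↔ G.IsSpanningTree (insert e F) ∧ e ∉ F := by
  have hE : (G.contractEdge e).edgeSet =
      G.edgeSet \ {f | ∃ x y, G.IsLink e x y ∧ G.IsLink f x y} := by simp [contractEdge]
  have hV : (G.contractEdge e).vertexSet = Quot.mk (G.IsLink e) '' G.vertexSet := by
    simp [contractEdge]
  rw [isSpanningTree_iff, isSpanningTree_iff, hV, Set.image_nonempty]
  have hins : ∀ {f}, f ∈ F → e ∉ F → insert e F \ {f} = insert e (F \ {f}) := by
    intro f hf he
    rw [Set.insert_sdiff_of_notMem]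
    rintro rfl; exact he hf
  constructor
  · rintro ⟨hF, h2, h3, h4⟩
    have he : e ∉ F := by
      intro he
      have := hF he
      rw [hE] at this
      exact this.2 ⟨x, y, hl, hl⟩
    rw [connects_contractEdge hF] at h3
    have h4' : ∀ f ∈ F, ¬ G.Connects (insert e F \ {f}) := by
      intro f hf
      rw [hins hf he, ← connects_contractEdge (Set.sdiff_subset.trans hF)]
      exact h4 f hf
    refine ⟨⟨Set.insert_subset hl.edge_mem fun f hf ↦ ?_, h2, h3, ?_⟩, he⟩
    · have := hF hf
      rw [hE] at this
      exact this.1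
    · rintro f (rfl | hf)
      · intro hc
        rw [Set.insert_sdiff_self_of_notMem he] at hc
        -- If `F` alone connected `G`, an exchange would make some edge of `F` redundant in `insert
        -- e F`.
        obtain ⟨g, hg, hc⟩ := hc.exists_exchange hxy hl he
        exact h4' g hg hc
      · exact h4' f hf
  · rintro ⟨⟨h1, h2, h3, h4⟩, he⟩
    have hF : F ⊆ (G.contractEdge e).edgeSet := by
      intro f hf
      rw [hE]
      refine ⟨h1 (.inr hf), ?_⟩
      rintro ⟨u, v, hu, hv⟩
      -- An edge parallel to `e` is redundant beside `e`.
      refine h4 f (.inr hf) (h3.replace hv (.single ⟨e, ⟨.inl rfl, ?_⟩, hu⟩) le_rfl)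
      rintro rfl; exact he hf
    refine ⟨hF, h2, (connects_contractEdge hF).2 h3, fun f hf ↦ ?_⟩
    rw [connects_contractEdge (Set.sdiff_subset.trans hF), ← hins hf he]
    exact h4 f (.inr hf)

lemma numSpanningTrees_deleteEdge :
    (G.deleteEdge e).numSpanningTrees = {F | G.IsSpanningTree F ∧ e ∉ F}.ncard := by
  simp only [numSpanningTrees, isSpanningTree_deleteEdge]

lemma numSpanningTrees_contractEdge (hxy : x ≠ y) (hl : G.IsLink e x y) :
    (G.contractEdge e).numSpanningTrees = {F | G.IsSpanningTree F ∧ e ∈ F}.ncard := by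
  simp only [numSpanningTrees, isSpanningTree_contractEdge hxy hl]
  refine Set.ncard_congr (fun F _ ↦ insert e F) (fun F h ↦ ⟨h.1, Set.mem_insert _ _⟩) ?_ ?_
  · rintro F F' ⟨-, h⟩ ⟨-, h'⟩ heq
    rw [← Set.insert_sdiff_self_of_notMem h, heq, Set.insert_sdiff_self_of_notMem h']
  · rintro F ⟨h, he⟩
    have : insert e (F \ {e}) = F := Set.insert_sdiff_self_of_mem he
    exact ⟨F \ {e}, ⟨by rwa [this], fun h ↦ h.2 rfl⟩, this⟩

end SpanningTree

/-! ### Fans and their spanning trees -/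

section Fan

/-- The last vertex of the path of a fan after `k` building steps. -/
def fanVertex (b : ℕ → Bool) : ℕ → ℕ
  | 0 => 1
  | k + 1 => if b k then fanVertex b k else fanVertex b k + 1

/-- The apex `0` if the `k`-th edge is a spoke, and the last vertex of the path otherwise. -/
def fanSource (b : ℕ → Bool) (k : ℕ) : ℕ := if b k then 0 else fanVertex b k

/-- A fan with apex `0` and path `1, 2, …`, built in `m` steps. In the step `k`, if `b k` is true
then a spoke is added which joins the apex to the last vertex of the path, and otherwise the path
is extended by an edge. -/
def fan (b : ℕ → Bool) (m : ℕ) : Graph ℕ ℕ where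
  vertexSet := {x | x ≤ fanVertex b m}
  edgeSet := Set.Iio m
  IsLink k x y := k < m ∧ (x = fanSource b k ∧ y = fanVertex b (k + 1) ∨
    y = fanSource b k ∧ x = fanVertex b (k + 1))
  isLink_symm k _ := ⟨by tauto⟩
  eq_or_eq_of_isLink_of_isLink := by
    rintro k x y v w ⟨-, h⟩ ⟨-, h'⟩
    omega
  edge_mem_iff_exists_isLink k :=
    ⟨fun h ↦ ⟨_, _, h, .inl ⟨rfl, rfl⟩⟩, fun ⟨_, _, h⟩ ↦ h.1⟩
  left_mem_of_isLink := by
    rintro k x y ⟨hk, h⟩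
    have hmono : Monotone (fanVertex b) := monotone_nat_of_le_succ fun k ↦ by
      rw [fanVertex]; split_ifs <;> omega
    have h1 : fanVertex b (k + 1) ≤ fanVertex b m := hmono hk
    have h2 : fanVertex b k ≤ fanVertex b m := hmono hk.le
    have h3 : fanSource b k ≤ fanVertex b k := by rw [fanSource]; split_ifs <;> omega
    show x ≤ _
    omega

variable {b : ℕ → Bool} {m : ℕ}

lemma fanVertex_monotone : Monotone (fanVertex b) := monotone_nat_of_le_succ fun k ↦ by
  rw [fanVertex]; split_ifs <;> omega

lemma one_le_fanVertex (k : ℕ) : 1 ≤ fanVertex b k := fanVertex_monotone (Nat.zero_le k)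

lemma fanSource_le (k : ℕ) : fanSource b k ≤ fanVertex b k := by
  rw [fanSource]; split_ifs <;> omega

lemma fanSource_lt (k : ℕ) : fanSource b k < fanVertex b (k + 1) := by
  have := one_le_fanVertex (b := b) k
  rw [fanSource, fanVertex]; split_ifs <;> omega

lemma fan_isLink {k : ℕ} (hk : k < m) :
    (fan b m).IsLink k (fanSource b k) (fanVertex b (k + 1)) := ⟨hk, .inl ⟨rfl, rfl⟩⟩

/-- The spanning trees of a fan, and its spanning forests with two components which separate the
apex from the last vertex of the path. -/
def fanTrees (b : ℕ → Bool) : ℕ → Finset (Finset ℕ) × Finset (Finset ℕ)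
  | 0 => (∅, {∅})
  | m + 1 =>
    if b m then
      ((fanTrees b m).1 ∪ (fanTrees b m).2.image (insert m), (fanTrees b m).2)
    else
      ((fanTrees b m).1.image (insert m), (fanTrees b m).1 ∪ (fanTrees b m).2.image (insert m))

/-- Within a family all members have the same size, so none properly contains another; this gives
the minimality in `isSpanningTree_fan_iff`. The bound on the edges makes `m` a new element in
`insert m`. -/
lemma fanTrees_props (m : ℕ) :
    (∀ F ∈ (fanTrees b m).1, (∀ k ∈ F, k < m) ∧ F.card = fanVertex b m) ∧
    (∀ F ∈ (fanTrees b m).2, (∀ k ∈ F, k < m) ∧ F.card + 1 = fanVertex b m) := by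
  induction m with
  | zero => simp [fanTrees, fanVertex]
  | succ m ih =>
    obtain ⟨h1, h2⟩ := ih
    have hins : ∀ F : Finset ℕ, (∀ k ∈ F, k < m) →
        (∀ k ∈ insert m F, k < m + 1) ∧ (insert m F).card = F.card + 1 := by
      intro F hF
      refine ⟨fun k hk ↦ ?_, Finset.card_insert_of_notMem fun h ↦ (hF m h).false⟩
      rcases Finset.mem_insert.1 hk with rfl | hk
      · omega
      · exact (hF k hk).trans (Nat.lt_succ_self _)
    have hw : ∀ F : Finset ℕ, (∀ k ∈ F, k < m) → ∀ k ∈ F, k < m + 1 :=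
      fun F h k hk ↦ (h k hk).trans (Nat.lt_succ_self _)
    rw [fanTrees, fanVertex]
    split_ifs with hb
    all_goals
      constructor <;> intro F hF <;>
        simp only [Finset.mem_union, Finset.mem_image] at hF
    · rcases hF with hF | ⟨F, hF, rfl⟩
      · exact ⟨hw F (h1 F hF).1, (h1 F hF).2⟩
      · have := hins F (h2 F hF).1
        exact ⟨this.1, this.2.trans (h2 F hF).2⟩
    · exact ⟨hw F (h2 F hF).1, (h2 F hF).2⟩
    · obtain ⟨F, hF, rfl⟩ := hF
      have := hins F (h1 F hF).1
      exact ⟨this.1, by rw [this.2, (h1 F hF).2]⟩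
    · rcases hF with hF | ⟨F, hF, rfl⟩
      · exact ⟨hw F (h1 F hF).1, by rw [(h1 F hF).2]⟩
      · have := hins F (h2 F hF).1
        exact ⟨this.1, by rw [this.2, (h2 F hF).2]⟩

lemma fan_adjIn_mono {m n : ℕ} (hmn : m ≤ n) {F F' : Set ℕ} (hF : F ⊆ F') {x y : ℕ}
    (h : ReflTransGen ((fan b m).AdjIn F) x y) : ReflTransGen ((fan b n).AdjIn F') x y := by
  refine ReflTransGen.mono ?_ _ _ h
  rintro x y ⟨k, hk, h⟩
  exact ⟨k, hF hk, h.1.trans_le hmn, h.2⟩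

lemma reach_of_mem_fanTrees (m : ℕ) :
    (∀ F ∈ (fanTrees b m).1, ∀ x, x ≤ fanVertex b m → ReflTransGen ((fan b m).AdjIn F) x 0) ∧
    (∀ F ∈ (fanTrees b m).2, ∀ x, x ≤ fanVertex b m →
      ReflTransGen ((fan b m).AdjIn F) x 0 ∨
      ReflTransGen ((fan b m).AdjIn F) x (fanVertex b m)) := by
  induction m with
  | zero =>
    refine ⟨by simp [fanTrees], fun F _ x hx ↦ ?_⟩
    simp only [fanVertex] at hx ⊢
    interval_cases x
    · exact .inl .refl
    · exact .inr .refl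
  | succ m ih =>
    obtain ⟨h1, h2⟩ := ih
    have up : ∀ {F : Finset ℕ} {x y}, ReflTransGen ((fan b m).AdjIn F) x y →
        ReflTransGen ((fan b (m + 1)).AdjIn F) x y :=
      fun h ↦ fan_adjIn_mono (Nat.le_succ m) le_rfl h
    have upi : ∀ {F : Finset ℕ} {x y}, ReflTransGen ((fan b m).AdjIn F) x y →
        ReflTransGen ((fan b (m + 1)).AdjIn ↑(insert m F)) x y :=
      fun h ↦ fan_adjIn_mono (Nat.le_succ m) (by simp) h
    have hnew : ∀ F : Finset ℕ, (fan b (m + 1)).AdjIn ↑(insert m F) (fanVertex b (m + 1))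
        (fanSource b m) := fun F ↦ ⟨m, by simp, (fan_isLink (Nat.lt_succ_self m)).symm⟩
    rw [fanTrees]
    by_cases hb : b m
    · have hv : fanVertex b (m + 1) = fanVertex b m := by simp [fanVertex, hb]
      have hs : fanSource b m = 0 := by simp [fanSource, hb]
      rw [hv, hs] at hnew
      rw [if_pos hb, hv]
      constructor <;> intro F hF x hx <;>
        simp only [Finset.mem_union, Finset.mem_image] at hF
      · rcases hF with hF | ⟨F, hF, rfl⟩
        · exact up (h1 F hF x hx)
        · rcases h2 F hF x hx with h | h
          · exact upi h
          · exact (upi h).tail (hnew F)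
      · exact (h2 F hF x hx).imp up up
    · have hv : fanVertex b (m + 1) = fanVertex b m + 1 := by simp [fanVertex, hb]
      have hs : fanSource b m = fanVertex b m := by simp [fanSource, hb]
      rw [hv, hs] at hnew
      rw [if_neg hb, hv]
      constructor <;> intro F hF x hx <;>
        simp only [Finset.mem_union, Finset.mem_image] at hF
      · obtain ⟨F, hF, rfl⟩ := hF
        rcases hx.lt_or_eq with hx | rfl
        · exact upi (h1 F hF x (by omega))
        · exact .head (hnew F) (upi (h1 F hF _ le_rfl))
      · rcases hx.lt_or_eq with hx | rfl
        · rcases hF with hF | ⟨F, hF, rfl⟩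
          · exact .inl (up (h1 F hF x (by omega)))
          · rcases h2 F hF x (by omega) with h | h
            · exact .inl (upi h)
            · exact .inr ((upi h).tail (hnew F).symm)
        · exact .inr .refl

/-- `X` is a union of components of the graph with edges `F` in a fan, and avoids the apex. -/
def FanSeparates (b : ℕ → Bool) (F : Set ℕ) (m : ℕ) (X : Set ℕ) : Prop :=
  X.Nonempty ∧ (∀ x ∈ X, 1 ≤ x ∧ x ≤ fanVertex b m) ∧
    ∀ k < m, k ∈ F → (fanSource b k ∈ X ↔ fanVertex b (k + 1) ∈ X)

lemma FanSeparates.succ {F X : Set ℕ} (h : FanSeparates b F m X)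
    (hm : m ∈ F → (fanSource b m ∈ X ↔ fanVertex b (m + 1) ∈ X)) :
    FanSeparates b F (m + 1) X := by
  refine ⟨h.1, fun x hx ↦ ⟨(h.2.1 x hx).1,
    (h.2.1 x hx).2.trans (fanVertex_monotone (Nat.le_succ m))⟩, fun k hk hkF ↦ ?_⟩
  rcases (Nat.lt_succ_iff.1 hk).lt_or_eq with hk | rfl
  · exact h.2.2 k hk hkF
  · exact hm hkF

/-- Completeness of the recursive lists: if `F` contains no listed tree, a cut certifies that it is
disconnected. The half on forests is carried along because the recursion mixes the two families. -/
lemma exists_fanTree_or_separates (F : Set ℕ) (m : ℕ) :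
    ((∃ F' ∈ (fanTrees b m).1, (F' : Set ℕ) ⊆ F) ∨ ∃ X, FanSeparates b F m X) ∧
    ((∃ F' ∈ (fanTrees b m).2, (F' : Set ℕ) ⊆ F) ∨
      ∃ X, FanSeparates b F m X ∧ fanVertex b m ∉ X) := by
  induction m with
  | zero =>
    refine ⟨.inr ⟨{1}, ⟨1, rfl⟩, ?_, by simp⟩, .inl ⟨∅, by simp [fanTrees], by simp⟩⟩
    simp [fanVertex]
  | succ m ih =>
    obtain ⟨h1, h2⟩ := ih
    have hins : ∀ F' : Finset ℕ, (F' : Set ℕ) ⊆ F → m ∈ F → ((insert m F' : Finset ℕ) : Set ℕ) ⊆ F :=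
      fun F' h hm ↦ by simpa [Set.insert_subset_iff] using ⟨hm, h⟩
    rw [fanTrees]
    by_cases hb : b m
    · have hv : fanVertex b (m + 1) = fanVertex b m := by simp [fanVertex, hb]
      have hs : fanSource b m = 0 := by simp [fanSource, hb]
      have key : ∀ X, FanSeparates b F m X → fanVertex b m ∉ X → FanSeparates b F (m + 1) X := by
        refine fun X hX hm ↦ hX.succ fun _ ↦ iff_of_false (fun h ↦ ?_) (hv ▸ hm)
        have := (hX.2.1 _ h).1
        omega
      simp only [if_pos hb, hv, Finset.mem_union, Finset.mem_image]
      constructor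
      · rcases h1 with ⟨F', hF', hF⟩ | ⟨X, hX⟩
        · exact .inl ⟨F', .inl hF', hF⟩
        by_cases hm : m ∈ F
        · rcases h2 with ⟨F', hF', hF⟩ | ⟨X, hX, hXm⟩
          · exact .inl ⟨_, .inr ⟨F', hF', rfl⟩, hins F' hF hm⟩
          · exact .inr ⟨X, key X hX hXm⟩
        · exact .inr ⟨X, hX.succ fun h ↦ absurd h hm⟩
      · exact h2.imp_right fun ⟨X, hX, hXm⟩ ↦ ⟨X, key X hX hXm, hXm⟩
    · have hv : fanVertex b (m + 1) = fanVertex b m + 1 := by simp [fanVertex, hb]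
      have hs : fanSource b m = fanVertex b m := by simp [fanSource, hb]
      have hnot : ∀ X, FanSeparates b F m X → fanVertex b m + 1 ∉ X := by
        intro X hX h
        have := (hX.2.1 _ h).2
        omega
      simp only [if_neg hb, hv, Finset.mem_union, Finset.mem_image]
      by_cases hm : m ∈ F
      · constructor
        · rcases h1 with ⟨F', hF', hF⟩ | ⟨X, hX⟩
          · exact .inl ⟨_, ⟨F', hF', rfl⟩, hins F' hF hm⟩
          -- The edge `m` lies in `F`, so the new vertex goes to the side of the old last vertex.
          refine .inr ⟨X ∪ {x | x = fanVertex b m + 1 ∧ fanVertex b m ∈ X}, hX.1.inl, ?_, ?_⟩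
          · rintro x (hx | ⟨rfl, -⟩)
            · have := hX.2.1 x hx
              omega
            · omega
          · intro k hk hkF
            have hmem : ∀ x ≤ fanVertex b m,
                (x ∈ X ∪ {x | x = fanVertex b m + 1 ∧ fanVertex b m ∈ X} ↔ x ∈ X) := by
              intro x hx
              have : x ≠ fanVertex b m + 1 := by omega
              simp [this]
            rcases (Nat.lt_succ_iff.1 hk).lt_or_eq with hk | rfl
            · rw [hmem _ ((fanSource_le k).trans (fanVertex_monotone hk.le)),
                hmem _ (fanVertex_monotone hk)]
              exact hX.2.2 k hk hkF
            · rw [hs, hv, hmem _ le_rfl]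
              simp [hnot X hX]
        · rcases h1 with ⟨F', hF', hF⟩ | -
          · exact .inl ⟨F', .inl hF', hF⟩
          rcases h2 with ⟨F', hF', hF⟩ | ⟨X, hX, hXm⟩
          · exact .inl ⟨_, .inr ⟨F', hF', rfl⟩, hins F' hF hm⟩
          · exact .inr ⟨X, hX.succ fun _ ↦ iff_of_false (hs ▸ hXm) (hv ▸ hnot X hX), hnot X hX⟩
      · constructor
        -- Without the edge `m` the new vertex is isolated.
        · refine .inr ⟨{fanVertex b m + 1}, ⟨_, rfl⟩, ?_, fun k hk hkF ↦ ?_⟩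
          · rintro _ rfl; omega
          rcases (Nat.lt_succ_iff.1 hk).lt_or_eq with hk | rfl
          · have h1 := (fanSource_le (b := b) k).trans (fanVertex_monotone hk.le)
            have h2 : fanVertex b (k + 1) ≤ fanVertex b m := fanVertex_monotone hk
            simp only [Set.mem_singleton_iff]
            omega
          · exact absurd hkF hm
        · rcases h1 with ⟨F', hF', hF⟩ | ⟨X, hX⟩
          · exact .inl ⟨F', .inl hF', hF⟩
          · exact .inr ⟨X, hX.succ fun h ↦ absurd h hm, hnot X hX⟩

lemma connects_fan_iff {F : Set ℕ} :
    (fan b m).Connects F ↔ ∃ F' ∈ (fanTrees b m).1, (F' : Set ℕ) ⊆ F := by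
  constructor
  · intro h
    refine (exists_fanTree_or_separates F m).1.resolve_right ?_
    rintro ⟨X, ⟨x, hx⟩, hX, hc⟩
    have hr := h x (hX x hx).2 0 (Nat.zero_le _)
    have : ∀ y, ReflTransGen ((fan b m).AdjIn F) x y → y ∈ X := by
      intro y hy
      induction hy with
      | refl => exact hx
      | tail _ h ih =>
        obtain ⟨k, hkF, hk, ⟨rfl, rfl⟩ | ⟨rfl, rfl⟩⟩ := h
        · exact (hc k hk hkF).1 ih
        · exact (hc k hk hkF).2 ih
    have := (hX 0 (this 0 hr)).1
    omega
  · rintro ⟨F', hF', hF⟩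
    refine Connects.mono hF fun x hx y hy ↦ ?_
    exact ((reach_of_mem_fanTrees m).1 F' hF' x hx).trans
      (reach_symm ((reach_of_mem_fanTrees m).1 F' hF' y hy))

lemma isSpanningTree_fan_iff {F : Set ℕ} :
    (fan b m).IsSpanningTree F ↔ ∃ F' ∈ (fanTrees b m).1, (F' : Set ℕ) = F := by
  rw [isSpanningTree_iff]
  constructor
  · rintro ⟨-, -, h, hmin⟩
    obtain ⟨F', hF', hF⟩ := connects_fan_iff.1 h
    refine ⟨F', hF', hF.antisymm fun f hf ↦ ?_⟩
    by_contra hf'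
    exact hmin f hf (connects_fan_iff.2 ⟨F', hF', Set.subset_sdiff_singleton hF hf'⟩)
  · rintro ⟨F, hF, rfl⟩
    have hp := (fanTrees_props m).1 F hF
    refine ⟨fun k hk ↦ hp.1 k hk, ⟨0, Nat.zero_le _⟩, connects_fan_iff.2 ⟨F, hF, le_rfl⟩, ?_⟩
    intro f hf hc
    obtain ⟨F', hF', hss⟩ := connects_fan_iff.1 hc
    have hlt : F' ⊂ F := by
      rw [← Finset.coe_ssubset]
      exact hss.trans_ssubset (Set.sdiff_singleton_ssubset.2 hf)
    have := Finset.card_lt_card hlt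
    rw [hp.2, ((fanTrees_props m).1 F' hF').2] at this
    exact this.false

/-! ### Counting trees by a linear recursion -/

lemma ncard_isSpanningTree_fan (p : Set ℕ → Prop)
    [DecidablePred fun F : Finset ℕ ↦ p F] :
    {F | (fan b m).IsSpanningTree F ∧ p F}.ncard =
      ((fanTrees b m).1.filter fun F : Finset ℕ ↦ p F).card := by
  have : {F | (fan b m).IsSpanningTree F ∧ p F} =
      (fun F : Finset ℕ ↦ (F : Set ℕ)) '' ((fanTrees b m).1.filter fun F : Finset ℕ ↦ p F) := by
    ext F
    simp only [isSpanningTree_fan_iff, Set.mem_ofPred_eq, Finset.coe_filter, Set.mem_image]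
    constructor
    · rintro ⟨⟨F, hF, rfl⟩, h⟩
      exact ⟨F, ⟨hF, h⟩, rfl⟩
    · rintro ⟨F, ⟨hF, h⟩, rfl⟩
      exact ⟨⟨F, hF, rfl⟩, h⟩
  rw [this, Set.ncard_image_of_injective _ Finset.coe_injective, Set.ncard_coe_finset]

/-- The effect of a building step on the numbers of trees and of two-component forests. -/
def fanStep (v : ℕ × ℕ) (s : Bool) : ℕ × ℕ := if s then (v.1 + v.2, v.2) else (v.1, v.1 + v.2)

/-- The numbers of members of `fanTrees b m` with the property `p`. -/
def fanCount (b : ℕ → Bool) (p : Finset ℕ → Prop) [DecidablePred p] (m : ℕ) : ℕ × ℕ :=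
  (((fanTrees b m).1.filter p).card, ((fanTrees b m).2.filter p).card)

lemma card_filter_image_insert (m : ℕ) (p : Finset ℕ → Prop) [DecidablePred p]
    {S : Finset (Finset ℕ)} (hS : ∀ F ∈ S, ∀ k ∈ F, k < m) :
    ((S.image (insert m)).filter p).card = (S.filter fun F ↦ p (insert m F)).card := by
  rw [Finset.filter_image, Finset.card_image_of_injOn]
  intro F hF F' hF' h
  simp only [Finset.coe_filter, Set.mem_ofPred_eq] at hF hF'
  rw [← Finset.erase_insert fun h ↦ (hS F hF.1 m h).false, h,
    Finset.erase_insert fun h ↦ (hS F' hF'.1 m h).false]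

lemma card_filter_union_insert (m : ℕ) (p : Finset ℕ → Prop) [DecidablePred p]
    {S T : Finset (Finset ℕ)} (hS : ∀ F ∈ S, ∀ k ∈ F, k < m) (hT : ∀ F ∈ T, ∀ k ∈ F, k < m) :
    ((T ∪ S.image (insert m)).filter p).card =
      (T.filter p).card + (S.filter fun F ↦ p (insert m F)).card := by
  rw [Finset.filter_union, Finset.card_union_of_disjoint, card_filter_image_insert m p hS]
  refine Finset.disjoint_filter_filter (Finset.disjoint_left.2 fun F hF hF' ↦ ?_)
  obtain ⟨F', -, rfl⟩ := Finset.mem_image.1 hF'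
  exact (hT _ hF m (Finset.mem_insert_self _ _)).false

lemma fanCount_succ (p : Finset ℕ → Prop) [DecidablePred p] (m : ℕ) :
    fanCount b p (m + 1) =
      let c := fanCount b p m
      let d := fanCount b (fun F ↦ p (insert m F)) m
      if b m then (c.1 + d.2, c.2) else (d.1, c.1 + d.2) := by
  have h := fanTrees_props (b := b) m
  have h1 : ∀ F ∈ (fanTrees b m).1, ∀ k ∈ F, k < m := fun F hF ↦ (h.1 F hF).1
  have h2 : ∀ F ∈ (fanTrees b m).2, ∀ k ∈ F, k < m := fun F hF ↦ (h.2 F hF).1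
  simp only [fanCount, fanTrees]
  split_ifs
  · simp only [card_filter_union_insert m p h2 h1]
  · simp only [card_filter_union_insert m p h2 h1, card_filter_image_insert m p h1]

/-- From step `i` on the property ignores the new edges, so the counts follow the plain recursion
from whatever pair has been reached. -/
lemma fanCount_add (p : Finset ℕ → Prop) [DecidablePred p] (i n : ℕ)
    (hp : ∀ k F, i ≤ k → (p (insert k F) ↔ p F)) :
    fanCount b p (i + n) =
      ((List.range n).map fun j ↦ b (i + j)).foldl fanStep (fanCount b p i) := by
  induction n with
  | zero => simp
  | succ n ih =>
    rw [List.range_succ, List.map_append, List.foldl_append, ← ih, ← add_assoc, fanCount_succ]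
    simp only [hp _ _ (Nat.le_add_right i n)]
    simp [fanStep]

lemma fanCount_of_forall {p q : Finset ℕ → Prop} [DecidablePred p] [DecidablePred q]
    (h : ∀ F : Finset ℕ, (∀ k ∈ F, k < m) → (p F ↔ q F)) : fanCount b p m = fanCount b q m := by
  have h' := fanTrees_props (b := b) m
  simp only [fanCount]
  congr 2
  · exact Finset.filter_congr fun F hF ↦ h F (h'.1 F hF).1
  · exact Finset.filter_congr fun F hF ↦ h F (h'.2 F hF).1

lemma fanCount_false (m : ℕ) : fanCount b (fun _ ↦ False) m = (0, 0) := by simp [fanCount]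

lemma fanCount_true_eq (n : ℕ) :
    fanCount b (fun _ ↦ True) n = ((List.range n).map b).foldl fanStep (0, 1) := by
  have := fanCount_add (b := b) (fun _ ↦ True) 0 n (by simp)
  simpa [fanCount, fanTrees] using this

lemma fanCount_notMem (e n : ℕ) (he : b e = true) :
    fanCount b (fun F ↦ e ∉ F) (e + 1 + n) = ((List.range n).map fun j ↦ b (e + 1 + j)).foldl
      fanStep (fanCount b (fun _ ↦ True) e) := by
  rw [fanCount_add]
  · congr 1
    rw [fanCount_succ]
    simp only [he, if_true, Finset.mem_insert, true_or, not_true, fanCount_false]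
    rw [fanCount_of_forall (q := fun _ ↦ True)]
    · simp
    · intro F hF
      simpa using fun h ↦ (hF e h).false
  · intro k F hk
    have : e ≠ k := by omega
    simp [this]

/-- Right after the spoke `e` is forced, each old forest gives a tree, and no separating forest is
left because `e` joins the apex to the last vertex. This is the starting pair. -/
lemma fanCount_mem (e n : ℕ) (he : b e = true) :
    fanCount b (fun F ↦ e ∈ F) (e + 1 + n) = ((List.range n).map fun j ↦ b (e + 1 + j)).foldl
      fanStep ((fanCount b (fun _ ↦ True) e).2, 0) := by
  rw [fanCount_add]
  · congr 1
    rw [fanCount_succ]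
    simp only [he, if_true, Finset.mem_insert, true_or]
    rw [fanCount_of_forall (p := fun F ↦ e ∈ F) (q := fun _ ↦ False), fanCount_false]
    · simp
    · intro F hF
      simpa using fun h ↦ (hF e h).false
  · intro k F hk
    have : e ≠ k := by omega
    simp [this]

/-- The numbers of trees and of two-component forests of the fan given by a list of steps. -/
def fanValue (L : List Bool) : ℕ × ℕ := L.foldl fanStep (0, 1)

lemma fanValue_concat (L : List Bool) (s : Bool) :
    fanValue (L ++ [s]) = fanStep (fanValue L) s := by simp [fanValue]

lemma fanValue_snd_pos (L : List Bool) : 0 < (fanValue L).2 := by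
  induction L using List.reverseRecOn with
  | nil => simp [fanValue]
  | append_singleton L s ih =>
    rw [fanValue_concat, fanStep]
    split_ifs <;> simp [ih]

/-- Each step is self-adjoint for the pairing `v.1 * w.2 + v.2 * w.1`; moving the steps across one
by one reverses their order. -/
lemma foldl_fanStep_reverse (L : List Bool) (v : ℕ × ℕ) :
    (L.reverse.foldl fanStep v).1 = v.1 * (fanValue L).2 + v.2 * (fanValue L).1 := by
  induction L using List.reverseRecOn generalizing v with
  | nil => simp [fanValue]
  | append_singleton L s ih =>
    rw [fanValue_concat, List.reverse_concat, List.foldl_cons, ih]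
    cases s <;> simp [fanStep] <;> ring

/-- The fan which has the lists of steps `L` and, reversed, `L'` on the two sides of a marked
spoke. -/
def fanOfLists (L L' : List Bool) : Graph ℕ ℕ :=
  -- The list has exactly as many entries as there are steps, so the default value is never used.
  fan (fun k ↦ (L ++ true :: L'.reverse).getD k true) (L.length + 1 + L'.length)

lemma fanOfLists_isLink (L L' : List Bool) :
    ∃ x y, x ≠ y ∧ (fanOfLists L L').IsLink L.length x y :=
  ⟨_, _, (fanSource_lt _).ne, fan_isLink (by omega)⟩

/-- If the sides have values `(t, f)` and `(t', f')`, then `t * f' + f * t'` trees avoid the marked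
spoke and `f * f'` contain it. -/
lemma spanningTreeRatio_fanOfLists (L L' : List Bool) :
    (fanOfLists L L').spanningTreeRatio L.length =
      ((fanValue L).1 : ℚ) / (fanValue L).2 + ((fanValue L').1 : ℚ) / (fanValue L').2 := by
  obtain ⟨x, y, hxy, hl⟩ := fanOfLists_isLink L L'
  rw [spanningTreeRatio, numSpanningTrees_deleteEdge, numSpanningTrees_contractEdge hxy hl,
    fanOfLists]
  set b : ℕ → Bool := fun k ↦ (L ++ true :: L'.reverse).getD k true with hbdef
  have he : b L.length = true := by simp [hbdef]
  have hL : (List.range L.length).map b = L := by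
    refine List.ext_getElem (by simp) fun i h1 h2 ↦ ?_
    simp [hbdef, List.getElem?_append_left h2, List.getElem?_eq_getElem h2]
  have hL' : (List.range L'.length).map (fun j ↦ b (L.length + 1 + j)) = L'.reverse := by
    refine List.ext_getElem (by simp) fun i h1 h2 ↦ ?_
    have : L.length + 1 + i - L.length = i + 1 := by omega
    simp [hbdef, List.getElem?_append_right (show L.length ≤ L.length + 1 + i by omega), this,
      List.getElem?_eq_getElem h2, -List.getElem?_reverse, -List.getElem_reverse]
  have hc : fanCount b (fun _ ↦ True) L.length = fanValue L := by
    rw [fanCount_true_eq, hL, fanValue]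
  have h0 := ncard_isSpanningTree_fan (b := b) (m := L.length + 1 + L'.length)
    (fun F ↦ L.length ∉ F)
  have h1 := ncard_isSpanningTree_fan (b := b) (m := L.length + 1 + L'.length)
    (fun F ↦ L.length ∈ F)
  have e0 := congrArg Prod.fst (fanCount_notMem (b := b) L.length L'.length he)
  have e1 := congrArg Prod.fst (fanCount_mem (b := b) L.length L'.length he)
  rw [hL', hc, foldl_fanStep_reverse] at e0 e1
  simp only [fanCount] at e0 e1
  simp only [Finset.mem_coe] at h0 h1
  rw [h0, h1, e0, e1]
  have p1 : ((fanValue L).2 : ℚ) ≠ 0 := by exact_mod_cast (fanValue_snd_pos L).ne'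
  have p2 : ((fanValue L').2 : ℚ) ≠ 0 := by exact_mod_cast (fanValue_snd_pos L').ne'
  push_cast
  field_simp
  ring

end Fan

/-! ### Connectedness and planarity of fans -/

section FanDrawing

variable {b : ℕ → Bool} {m : ℕ}

lemma fanTrees_snd_nonempty (m : ℕ) : (fanTrees b m).2.Nonempty := by
  induction m with
  | zero => simp [fanTrees]
  | succ m ih =>
    rw [fanTrees]
    split_ifs
    · exact ih
    · exact .inr (ih.image _)

lemma fanTrees_fst_nonempty {k : ℕ} (hk : k < m) (hb : b k = true) :
    (fanTrees b m).1.Nonempty := by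
  induction m with
  | zero => omega
  | succ m ih =>
    rw [fanTrees]
    split_ifs with hm
    · exact .inr ((fanTrees_snd_nonempty m).image _)
    · have : k ≠ m := by rintro rfl; exact hm hb
      exact (ih (by omega)).image _

lemma isConnected_fan {k : ℕ} (hk : k < m) (hb : b k = true) : (fan b m).IsConnected := by
  obtain ⟨F, hF⟩ := fanTrees_fst_nonempty hk hb
  have := (isConnected_restrict (G := fan b m) (F := (fan b m).edgeSet)).2
    ⟨⟨0, Nat.zero_le _⟩, connects_fan_iff.2 ⟨F, hF, fun k hk ↦ ((fanTrees_props m).1 F hF).1 k hk⟩⟩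
  rwa [restrict_self] at this

/-- The apex is the origin and the path lies on the line at height `1`. -/
noncomputable def fanPoint (i : ℕ) : ℝ × ℝ := (i, if i = 0 then 0 else 1)

/-- The spokes are pairwise disjoint parabolic arcs. -/
noncomputable def fanCurve (b : ℕ → Bool) (k : ℕ) (t : ℝ) : ℝ × ℝ :=
  if b k then (t * fanVertex b k + t * (1 - t) * k, t) else (fanVertex b k + t, 1)

/-- At a fixed height strictly between 0 and 1 the abscissa of a spoke increases strictly with its
index: the end vertex moves weakly to the right and the bulge `t * (1 - t) * k` grows. This
separates parallel spokes too. -/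
lemma fanCurve_eq {k l : ℕ} {s t : ℝ} (hs : s ∈ Set.Ioo (0 : ℝ) 1) (ht : t ∈ Set.Ioo (0 : ℝ) 1)
    (h : fanCurve b k s = fanCurve b l t) : k = l ∧ s = t := by
  wlog hkl : k ≤ l generalizing k l s t
  · have := this ht hs h.symm (by omega)
    exact ⟨this.1.symm, this.2.symm⟩
  obtain ⟨hs0, hs1⟩ := hs
  obtain ⟨ht0, ht1⟩ := ht
  have hmono : (fanVertex b k : ℝ) ≤ fanVertex b l := by exact_mod_cast fanVertex_monotone hkl
  rw [fanCurve, fanCurve] at h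
  split_ifs at h with hk hl hl <;> rw [Prod.mk.injEq] at h <;> obtain ⟨h1, h2⟩ := h
  · subst h2
    refine ⟨?_, rfl⟩
    by_contra hne
    have hlt : (k : ℝ) < l := by exact_mod_cast lt_of_le_of_ne hkl hne
    have h3 : s * fanVertex b k ≤ s * fanVertex b l := by gcongr
    have h4 : s * (1 - s) * k < s * (1 - s) * l :=
      mul_lt_mul_of_pos_left hlt (mul_pos hs0 (by linarith))
    linarith
  · linarith
  · linarith
  · rcases hkl.lt_or_eq with hlt | rfl
    · have h3 : fanVertex b k + 1 ≤ fanVertex b l := by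
        have : fanVertex b (k + 1) ≤ fanVertex b l := fanVertex_monotone hlt
        simpa [fanVertex, hk] using this
      have h4 : (fanVertex b k : ℝ) + 1 ≤ fanVertex b l := by exact_mod_cast h3
      linarith
    · exact ⟨rfl, by linarith⟩

lemma isPlanar_fan : (fan b m).IsPlanar := by
  refine ⟨⟨fanPoint, fanCurve b, ?_, ?_, ?_, ?_, ?_⟩⟩
  · intro i _ j _ h
    have : (i : ℝ) = j := congrArg Prod.fst h
    exact_mod_cast this
  · intro k _
    by_cases hb : b k
    · have : fanCurve b k = fun t : ℝ ↦ (t * fanVertex b k + t * (1 - t) * k, t) := by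
        ext1 t; simp [fanCurve, hb]
      rw [this]; fun_prop
    · have : fanCurve b k = fun t : ℝ ↦ ((fanVertex b k : ℝ) + t, 1) := by
        ext1 t; simp [fanCurve, hb]
      rw [this]; fun_prop
  · intro k hk
    refine ⟨_, _, fan_isLink hk, ?_⟩
    have := one_le_fanVertex (b := b) k
    by_cases hb : b k
    · simp [fanSource, fanVertex, fanCurve, fanPoint, hb]
      omega
    · simp [fanSource, fanVertex, fanCurve, fanPoint, hb]
      omega
  · rintro k - t ⟨ht0, ht1⟩ x - h
    rw [fanCurve, fanPoint] at h
    split_ifs at h <;> rw [Prod.mk.injEq] at h <;> obtain ⟨h1, h2⟩ := h <;> try linarith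
    have h3 : (fanVertex b k : ℝ) < x := by linarith
    have h4 : (x : ℝ) < fanVertex b k + 1 := by linarith
    norm_cast at h3 h4
    omega
  · intro k _ l _ s hs t ht h
    exact fanCurve_eq hs ht h

end FanDrawing

/-! ### Continued fractions from fans -/

section Euclid

lemma fanValue_append_true (L : List Bool) (a : ℕ) :
    fanValue (L ++ List.replicate a true) =
      ((fanValue L).1 + a * (fanValue L).2, (fanValue L).2) := by
  induction a with
  | zero => simp
  | succ a ih =>
    rw [List.replicate_succ', ← List.append_assoc, fanValue_concat, ih]
    simp [fanStep]; ring

lemma fanValue_append_false (L : List Bool) (a : ℕ) :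
    fanValue (L ++ List.replicate a false) =
      ((fanValue L).1, (fanValue L).2 + a * (fanValue L).1) := by
  induction a with
  | zero => simp
  | succ a ih =>
    rw [List.replicate_succ', ← List.append_assoc, fanValue_concat, ih]
    simp [fanStep]; ring

/-- The sum of the quotients in the Euclidean algorithm. -/
def quotientSum (x y : ℕ) : ℕ :=
  if _h : y = 0 then 0 else x / y + quotientSum y (x % y)
termination_by y
decreasing_by exact Nat.mod_lt _ (Nat.pos_of_ne_zero _h)

lemma quotientSum_zero (x : ℕ) : quotientSum x 0 = 0 := by rw [quotientSum]; simp

lemma quotientSum_of_pos {x y : ℕ} (hy : 0 < y) :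
    quotientSum x y = x / y + quotientSum y (x % y) := by
  rw [quotientSum, dif_neg hy.ne']

/-- A run of spokes adds a quotient to the value, a run of path edges adds it to the reciprocal.
Both orientations are proved together since a division step exchanges them. -/
lemma exists_fanValue_aux (y : ℕ) : ∀ x : ℕ,
    (0 < y → ∃ L, (fanValue L).1 * y = x * (fanValue L).2 ∧ L.length ≤ quotientSum x y) ∧
    (0 < x → ∃ L, (fanValue L).1 * x = y * (fanValue L).2 ∧ L.length ≤ quotientSum x y) := by
  induction y using Nat.strong_induction_on with
  | _ y ih =>
    intro x
    rcases Nat.eq_zero_or_pos y with rfl | hy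
    · exact ⟨fun h ↦ absurd h (lt_irrefl 0), fun _ ↦ ⟨[], by simp [fanValue]⟩⟩
    obtain ⟨ih1, ih2⟩ := ih (x % y) (Nat.mod_lt _ hy) y
    have hx := Nat.div_add_mod x y
    rw [quotientSum_of_pos hy]
    constructor
    · intro _
      obtain ⟨L, hL, hlen⟩ := ih2 hy
      refine ⟨L ++ List.replicate (x / y) true, ?_, by simp; omega⟩
      rw [fanValue_append_true]
      calc _ = (fanValue L).1 * y + x / y * (fanValue L).2 * y := by ring
        _ = (y * (x / y) + x % y) * (fanValue L).2 := by rw [hL]; ring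
        _ = _ := by rw [hx]
    · intro hx0
      rcases Nat.eq_zero_or_pos (x % y) with h0 | h0
      · have ha : 0 < x / y := Nat.pos_of_ne_zero fun h ↦ by simp [h, h0] at hx; omega
        -- Path edges leave the initial value 0 unchanged, so `1 / a` needs a first spoke, which
        -- already accounts for one unit of `a`.
        refine ⟨[true] ++ List.replicate (x / y - 1) false, ?_, by simp; omega⟩
        rw [fanValue_append_false]
        have : 1 + (x / y - 1) = x / y := by omega
        simp only [fanValue, List.foldl_cons, List.foldl_nil, fanStep, if_true]
        rw [h0] at hx
        simp only [zero_add, one_mul, mul_one, this]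
        omega
      · obtain ⟨L, hL, hlen⟩ := ih1 h0
        refine ⟨L ++ List.replicate (x / y) false, ?_, by simp; omega⟩
        rw [fanValue_append_false]
        calc _ = (fanValue L).1 * (y * (x / y) + x % y) := by rw [hx]
          _ = (fanValue L).1 * (x % y) + (fanValue L).1 * (y * (x / y)) := by ring
          _ = _ := by rw [hL]; ring

lemma exists_fanValue {x : ℕ} (hx : 0 < x) (y : ℕ) :
    ∃ L, ((fanValue L).1 : ℚ) / (fanValue L).2 = (y : ℚ) / x ∧ L.length ≤ quotientSum x y := by
  obtain ⟨L, hL, hlen⟩ := (exists_fanValue_aux y x).2 hx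
  refine ⟨L, ?_, hlen⟩
  have := fanValue_snd_pos L
  rw [div_eq_div_iff (by positivity) (by positivity)]
  exact_mod_cast hL

end Euclid

/-! ### Residues with small quotient sums -/

section Residues

variable {B : ℕ}

/-- `q * x` has a positive residue of size at most `B / (q * m)`. -/
def IsSmallMultiple (x : ZMod B) (q m : ℕ) : Prop :=
  1 ≤ (q * x : ZMod B).val ∧ (q * x : ZMod B).val * (q * m) ≤ B

instance (x : ZMod B) (q m : ℕ) : Decidable (IsSmallMultiple x q m) :=
  inferInstanceAs (Decidable (_ ∧ _))

/-- The number of pairs `(q, m)` with `s ≤ q` and `m ≤ M` for which `x` has a small multiple. -/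
def smallMultiples (M : ℕ) (x : ZMod B) (s : ℕ) : ℕ :=
  ∑ q ∈ Finset.Ico s (B + 1), ((Finset.Icc 1 M).filter fun m ↦ IsSmallMultiple x q m).card

lemma smallMultiples_anti (M : ℕ) (x : ZMod B) {s t : ℕ} (h : s ≤ t) :
    smallMultiples M x t ≤ smallMultiples M x s :=
  Finset.sum_le_sum_of_subset (Finset.Ico_subset_Ico_left h)

/-- Here `q'` and `q` are consecutive convergent denominators. The quotient `a` satisfies `r * q * a
≤ q * r' ≤ B`, so every `m ≤ a` is counted at `q`, and `a ≤ M` by the exclusion of `M + 1`. The sign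
of the residue alternates, whence `x` and `-x`; later denominators are at least `q + q'`, so nothing
is counted twice. -/
lemma quotientSum_le_aux {M : ℕ} [NeZero B] (r : ℕ) : ∀ (x : ZMod B) (r' q q' : ℕ),
    (∀ n ∈ Finset.Icc 1 B, ¬ IsSmallMultiple x n (M + 1)) →
    (∀ n ∈ Finset.Icc 1 B, ¬ IsSmallMultiple (-x) n (M + 1)) →
    0 < q → r < r' → B = q * r' + q' * r → (r : ZMod B) = q * x → (r' : ZMod B) = -(q' * x) →
    quotientSum r' r ≤ smallMultiples M x q + smallMultiples M (-x) (q + q') := by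
  induction r using Nat.strong_induction_on with
  | _ r ih =>
    intro x r' q q' hx hx' hq hr hB h1 h2
    rcases Nat.eq_zero_or_pos r with rfl | hr0
    · simp [quotientSum_zero]
    rw [quotientSum_of_pos hr0]
    have hdiv := Nat.div_add_mod r' r
    set a := r' / r with ha
    have ha1 : 1 ≤ a := (Nat.one_le_div_iff hr0).2 hr.le
    have hqr : q * r' ≤ B := by omega
    have hrB : r' ≤ B := (Nat.le_mul_of_pos_left r' hq).trans hqr
    have hqB : q ≤ B := (Nat.le_mul_of_pos_right q (by omega)).trans hqr
    have hval : (q * x : ZMod B).val = r := by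
      rw [← h1, ZMod.val_natCast, Nat.mod_eq_of_lt (by omega)]
    have hsmall : ∀ m ≤ a, IsSmallMultiple x q m := by
      intro m hm
      rw [IsSmallMultiple, hval]
      refine ⟨hr0, le_trans ?_ hqr⟩
      calc r * (q * m) ≤ r * (q * a) := by gcongr
        _ = q * (r * a) := by ring
        _ ≤ q * r' := by gcongr; omega
    have haM : a ≤ M := by
      by_contra h
      exact hx q (by simp; omega) (hsmall (M + 1) (by omega))
    have hterm : a ≤ ((Finset.Icc 1 M).filter fun m ↦ IsSmallMultiple x q m).card := by
      calc a = (Finset.Icc 1 a).card := by simp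
        _ ≤ _ := Finset.card_le_card fun m hm ↦ by
          simp only [Finset.mem_Icc, Finset.mem_filter] at hm ⊢
          exact ⟨by omega, hsmall m hm.2⟩
    have hsplit : smallMultiples M x q =
        ((Finset.Icc 1 M).filter fun m ↦ IsSmallMultiple x q m).card +
          smallMultiples M x (q + 1) := by
      rw [smallMultiples, Finset.sum_eq_sum_Ico_succ_bot (by omega), smallMultiples]
    have hlt : r' % r < r := Nat.mod_lt _ hr0
    have hqa : q ≤ a * q := Nat.le_mul_of_pos_left q ha1
    have key := ih (r' % r) hlt (-x) r (a * q + q') q hx' (by simpa using hx) (by omega) hlt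
      (by
        calc B = q * (r * a + r' % r) + q' * r := by rw [hdiv]; exact hB
          _ = _ := by ring)
      (by
        have : (r : ZMod B) * a + (r' % r : ℕ) = r' := by exact_mod_cast congrArg Nat.cast hdiv
        rw [← eq_sub_iff_add_eq'] at this
        rw [this, h1, h2]
        push_cast
        ring)
      (by rw [h1]; ring)
    rw [neg_neg] at key
    have m1 := smallMultiples_anti M (-x) (show q + q' ≤ a * q + q' by omega)
    have m2 := smallMultiples_anti M x (show q + 1 ≤ a * q + q' + q by omega)
    omega

lemma quotientSum_le {M : ℕ} [NeZero B] (x : ZMod B)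
    (hx : ∀ n ∈ Finset.Icc 1 B, ¬ IsSmallMultiple x n (M + 1))
    (hx' : ∀ n ∈ Finset.Icc 1 B, ¬ IsSmallMultiple (-x) n (M + 1)) :
    quotientSum B x.val ≤ smallMultiples M x 1 + smallMultiples M (-x) 1 := by
  have := quotientSum_le_aux x.val x B 1 0 hx hx' one_pos x.val_lt (by simp) (by simp) (by simp)
  simpa using this

/-- Let `g` be the gcd of `q` and `B = b * g`. The values are multiples of `g`, each taken `g`
times, and `c / b` tells these apart. The value 0 must be excluded, as it alone has `g` solutions
however small `Y` is. -/
lemma card_mul_mod_le {q : ℕ} (hq : 0 < q) (hB : 0 < B) (Y : ℕ) :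
    ((Finset.range B).filter fun c ↦ 1 ≤ q * c % B ∧ q * c % B ≤ Y).card ≤ Y := by
  obtain ⟨g, q₁, b, hg, hcop, rfl, rfl⟩ := Nat.exists_coprime' (m := q) (n := B)
    (Nat.gcd_pos_of_pos_left B hq)
  have hb : 0 < b := Nat.pos_of_mul_pos_right hB
  have hmod : ∀ c, q₁ * g * c % (b * g) = q₁ * c % b * g := by
    intro c
    rw [← Nat.mul_mod_mul_right]
    congr 1
    ring
  simp only [hmod]
  conv_rhs => rw [← Finset.card_range Y]
  refine Finset.card_le_card_of_injOn (fun c ↦ (q₁ * c % b - 1) * g + c / b) ?_ ?_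
  · intro c hc
    simp only [Finset.coe_filter, Finset.mem_range, Set.mem_ofPred_eq, Finset.coe_range,
      Set.mem_Iio] at hc ⊢
    obtain ⟨hc, h1, h2⟩ := hc
    have hcb : c / b < g := Nat.div_lt_of_lt_mul hc
    obtain ⟨v, hv⟩ : ∃ v, q₁ * c % b = v + 1 :=
      ⟨_, (Nat.sub_add_cancel (Nat.pos_of_mul_pos_right h1)).symm⟩
    rw [hv] at h2 ⊢
    rw [add_mul, one_mul] at h2
    simp only [Nat.add_sub_cancel]
    omega
  · intro c hc d hd h
    simp only [Finset.coe_filter, Finset.mem_range, Set.mem_ofPred_eq] at hc hd h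
    have hcb : c / b < g := Nat.div_lt_of_lt_mul hc.1
    have hdb : d / b < g := Nat.div_lt_of_lt_mul hd.1
    have e1 : c / b = d / b := by
      have := congrArg (· % g) h
      simpa [Nat.add_mod, Nat.mod_eq_of_lt hcb, Nat.mod_eq_of_lt hdb] using this
    rw [e1] at h
    have e2 : q₁ * c % b - 1 = q₁ * d % b - 1 := Nat.eq_of_mul_eq_mul_right hg (by omega)
    have p1 : 0 < q₁ * c % b := Nat.pos_of_mul_pos_right hc.2.1
    have p2 : 0 < q₁ * d % b := Nat.pos_of_mul_pos_right hd.2.1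
    have e3 : q₁ * c ≡ q₁ * d [MOD b] := by
      show q₁ * c % b = q₁ * d % b
      omega
    have e4 : c ≡ d [MOD b] := Nat.ModEq.cancel_left_of_coprime hcop.symm e3
    rw [← Nat.div_add_mod c b, ← Nat.div_add_mod d b, e1, e4]

lemma card_isSmallMultiple_le [NeZero B] {q m : ℕ} (hq : 0 < q) (hm : 0 < m) :
    ((Finset.univ.filter fun x : ZMod B ↦ IsSmallMultiple x q m).card : ℝ) ≤ B / (q * m) := by
  have hB : 0 < B := NeZero.pos B
  have hqm : 0 < q * m := Nat.mul_pos hq hm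
  have h : (Finset.univ.filter fun x : ZMod B ↦ IsSmallMultiple x q m).card ≤ B / (q * m) := by
    refine le_trans ?_ (card_mul_mod_le hq hB (B / (q * m)))
    refine Finset.card_le_card_of_injOn ZMod.val ?_ (ZMod.val_injective B).injOn
    intro x hx
    simp only [Finset.coe_filter, Finset.mem_univ, true_and, Set.mem_ofPred_eq,
      Finset.mem_range] at hx ⊢
    have hv : (q * x : ZMod B).val = q * x.val % B := by
      rw [ZMod.val_mul, ZMod.val_natCast, Nat.mod_mul_mod]
    rw [IsSmallMultiple, hv] at hx
    exact ⟨x.val_lt, hx.1, (Nat.le_div_iff_mul_le hqm).2 hx.2⟩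
  calc _ ≤ ((B / (q * m) : ℕ) : ℝ) := by exact_mod_cast h
    _ ≤ (B : ℝ) / ((q * m : ℕ) : ℝ) := Nat.cast_div_le
    _ = _ := by push_cast; rfl

lemma harmonic_eq_sum (n : ℕ) : (harmonic n : ℝ) = ∑ i ∈ Finset.Icc 1 n, (1 : ℝ) / i := by
  rw [harmonic_eq_sum_Icc]; push_cast; simp

lemma sum_smallMultiples_le [NeZero B] (M : ℕ) :
    ∑ x : ZMod B, (smallMultiples M x 1 : ℝ) ≤ B * harmonic B * harmonic M := by
  have : ∑ x : ZMod B, smallMultiples M x 1 = ∑ q ∈ Finset.Icc 1 B, ∑ m ∈ Finset.Icc 1 M,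
      (Finset.univ.filter fun x : ZMod B ↦ IsSmallMultiple x q m).card := by
    simp only [smallMultiples, Finset.card_filter]
    rw [Finset.sum_comm]
    exact Finset.sum_congr rfl fun q _ ↦ Finset.sum_comm
  rw [← Nat.cast_sum, this]
  push_cast
  rw [harmonic_eq_sum, harmonic_eq_sum, mul_assoc, Finset.sum_mul_sum, Finset.mul_sum]
  refine Finset.sum_le_sum fun q hq ↦ ?_
  rw [Finset.mul_sum]
  refine Finset.sum_le_sum fun m hm ↦ ?_
  refine (card_isSmallMultiple_le (Finset.mem_Icc.1 hq).1 (Finset.mem_Icc.1 hm).1).trans_eq ?_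
  rw [div_mul_div_comm, mul_div_assoc', one_mul, mul_one]

lemma sum_exceptional_le [NeZero B] (M : ℕ) :
    ∑ x : ZMod B, (((Finset.Icc 1 B).filter fun q ↦ IsSmallMultiple x q (M + 1)).card : ℝ) ≤
      B * harmonic B / (M + 1) := by
  rw [← Nat.cast_sum]
  have : ∑ x : ZMod B, ((Finset.Icc 1 B).filter fun q ↦ IsSmallMultiple x q (M + 1)).card =
      ∑ q ∈ Finset.Icc 1 B,
        (Finset.univ.filter fun x : ZMod B ↦ IsSmallMultiple x q (M + 1)).card := by
    simp only [Finset.card_filter]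
    exact Finset.sum_comm
  rw [this]
  push_cast
  rw [harmonic_eq_sum, Finset.mul_sum, Finset.sum_div]
  refine Finset.sum_le_sum fun q hq ↦ ?_
  refine (card_isSmallMultiple_le (Finset.mem_Icc.1 hq).1 (Nat.succ_pos M)).trans_eq ?_
  rw [mul_one_div, div_div]
  push_cast
  rfl

/-- Every residue `a` is a sum of two residues with small sums of partial quotients. -/
lemma exists_add_quotientSum_le [NeZero B] (a : ZMod B) :
    ∃ x y : ZMod B, x + y = a ∧ ((quotientSum B x.val + quotientSum B y.val : ℕ) : ℝ) ≤
      8 * harmonic B * harmonic ⌈(8 * harmonic B : ℝ)⌉₊ := by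
  have hB : 0 < B := NeZero.pos B
  have hB' : (0 : ℝ) < B := by exact_mod_cast hB
  have hH : (0 : ℝ) < harmonic B := by exact_mod_cast harmonic_pos hB.ne'
  -- With this `M` the exceptional pairs number less than `B / 8`; `X` scales the other part of the
  -- weight to total at most `B / 8`. Four weights then average below 1.
  set M := ⌈(8 * harmonic B : ℝ)⌉₊ with hMdef
  have hM : (8 * harmonic B : ℝ) ≤ M := Nat.le_ceil _
  have hM0 : 0 < M := by
    have : (0 : ℝ) < M := by linarith
    exact_mod_cast this
  have hHM : (0 : ℝ) < harmonic M := by exact_mod_cast harmonic_pos hM0.ne'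
  set X : ℝ := 8 * harmonic B * harmonic M with hX
  have hX0 : 0 < X := by positivity
  let w : ZMod B → ℝ := fun x ↦ (smallMultiples M x 1 : ℝ) / X +
    (((Finset.Icc 1 B).filter fun q ↦ IsSmallMultiple x q (M + 1)).card : ℝ)
  have hw : 4 * ∑ x, w x < B := by
    simp only [w, Finset.sum_add_distrib, ← Finset.sum_div]
    have h1 : (∑ x : ZMod B, (smallMultiples M x 1 : ℝ)) / X ≤ B / 8 := by
      rw [div_le_iff₀ hX0]
      refine (sum_smallMultiples_le M).trans_eq ?_
      rw [hX]; ring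
    have h2 : B * (harmonic B : ℝ) / (M + 1) < B / 8 := by
      rw [div_lt_iff₀ (by positivity)]
      nlinarith
    linarith [sum_exceptional_le (B := B) M]
  have hsum : ∑ x, (w x + w (-x) + w (a - x) + w (-(a - x))) < ∑ _x : ZMod B, (1 : ℝ) := by
    have e1 : ∑ x, w (-x) = ∑ x, w x := Equiv.sum_comp (Equiv.neg (ZMod B)) w
    have e2 : ∑ x, w (a - x) = ∑ x, w x := Equiv.sum_comp (Equiv.subLeft a) w
    have e3 : ∑ x, w (-(a - x)) = ∑ x, w x :=
      (Equiv.sum_comp (Equiv.subLeft a) fun x ↦ w (-x)).trans e1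
    rw [Finset.sum_add_distrib, Finset.sum_add_distrib, Finset.sum_add_distrib, e1, e2, e3]
    simp only [Finset.sum_const, Finset.card_univ, ZMod.card, nsmul_eq_mul, mul_one]
    linarith
  obtain ⟨x, -, hx⟩ := Finset.exists_lt_of_sum_lt hsum
  have hw0 : ∀ x : ZMod B, 0 ≤ (smallMultiples M x 1 : ℝ) / X := fun x ↦ by positivity
  have hwge : ∀ x : ZMod B, (smallMultiples M x 1 : ℝ) / X ≤ w x := fun x ↦
    le_add_of_nonneg_right (Nat.cast_nonneg _)
  -- The exceptional count is an integer, so a weight below 1 forces it to vanish.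
  have hexc : ∀ y, w y < 1 → ∀ n ∈ Finset.Icc 1 B, ¬ IsSmallMultiple y n (M + 1) := by
    intro y hy n hn hs
    have hc : 1 ≤ ((Finset.Icc 1 B).filter fun q ↦ IsSmallMultiple y q (M + 1)).card :=
      Finset.card_pos.2 ⟨n, Finset.mem_filter.2 ⟨hn, hs⟩⟩
    have hc' : (1 : ℝ) ≤ ((Finset.Icc 1 B).filter fun q ↦ IsSmallMultiple y q (M + 1)).card := by
      exact_mod_cast hc
    have := hw0 y
    simp only [w] at hy
    linarith
  have g1 := (hw0 x).trans (hwge x)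
  have g2 := (hw0 (-x)).trans (hwge (-x))
  have g3 := (hw0 (a - x)).trans (hwge (a - x))
  have g4 := (hw0 (-(a - x))).trans (hwge (-(a - x)))
  have q1 := quotientSum_le x (hexc x (by linarith)) (hexc (-x) (by linarith))
  have q2 := quotientSum_le (a - x) (hexc (a - x) (by linarith)) (hexc (-(a - x)) (by linarith))
  refine ⟨x, a - x, by ring, ?_⟩
  have hle : ((smallMultiples M x 1 : ℝ) + smallMultiples M (-x) 1 + smallMultiples M (a - x) 1 +
      smallMultiples M (-(a - x)) 1) / X ≤ 1 := by
    rw [add_div, add_div, add_div]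
    linarith [hwge x, hwge (-x), hwge (a - x), hwge (-(a - x))]
  rw [div_le_one hX0] at hle
  refine le_trans ?_ hle
  exact_mod_cast (by omega)

end Residues

/-! ### Splitting the ratio and estimating the number of edges -/

/-- The representatives satisfy `x + y < 2 * B ≤ A + B` and `x + y ≡ A`, so `A` exceeds their sum by
0, 1 or 2 times `B`, supplied by extra spokes. These and the marked spoke make up the 3. -/
lemma exists_lists_of_ratio {A B : ℕ} (hB : 1 ≤ B) (hBA : B ≤ A) (hA : A ≤ 2 * B) :
    ∃ L L' : List Bool,
      ((fanValue L).1 : ℚ) / (fanValue L).2 + ((fanValue L').1 : ℚ) / (fanValue L').2 = A / B ∧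
      (L.length + 1 + L'.length : ℝ) ≤
        8 * harmonic B * harmonic ⌈(8 * harmonic B : ℝ)⌉₊ + 3 := by
  have : NeZero B := ⟨by omega⟩
  obtain ⟨x, y, hxy, hle⟩ := exists_add_quotientSum_le (A : ZMod B)
  have hx := x.val_lt
  have hy := y.val_lt
  obtain ⟨k, hk, hAk⟩ : ∃ k ≤ 2, x.val + y.val + k * B = A := by
    have hmod : x.val + y.val ≡ A [MOD B] := by
      rw [← ZMod.natCast_eq_natCast_iff]
      simpa using hxy
    have hle : x.val + y.val ≤ A := by
      by_contra hlt
      have := (Nat.modEq_iff_dvd' (by omega)).1 hmod.symm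
      have := Nat.le_of_dvd (by omega) this
      omega
    obtain ⟨k, hk⟩ := (Nat.modEq_iff_dvd' hle).1 hmod
    rw [mul_comm] at hk
    exact ⟨k, Nat.le_of_mul_le_mul_right (by omega) hB, by omega⟩
  obtain ⟨L, hL, hlen⟩ := exists_fanValue hB x.val
  obtain ⟨L', hL', hlen'⟩ := exists_fanValue hB y.val
  refine ⟨L ++ List.replicate k true, L', ?_, ?_⟩
  · have h0 : ((fanValue L).2 : ℚ) ≠ 0 := by exact_mod_cast (fanValue_snd_pos L).ne'
    have hB0 : (B : ℚ) ≠ 0 := by exact_mod_cast (by omega : B ≠ 0)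
    rw [fanValue_append_true, hL', ← hAk]
    push_cast
    rw [add_div, hL, mul_div_cancel_right₀ _ h0, add_div, add_div, mul_div_cancel_right₀ _ hB0]
    ring
  · have : (L ++ List.replicate k true).length + 1 + L'.length ≤
        quotientSum B x.val + quotientSum B y.val + 3 := by
      simp only [List.length_append, List.length_replicate]
      omega
    have : (((L ++ List.replicate k true).length + 1 + L'.length : ℕ) : ℝ) ≤
        ((quotientSum B x.val + quotientSum B y.val + 3 : ℕ) : ℝ) := by exact_mod_cast this
    push_cast at this hle ⊢
    linarith

lemma harmonic_bound {B N : ℕ} (hB : 1 ≤ B) (hBN : B ≤ N) :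
    8 * harmonic B * harmonic ⌈(8 * harmonic B : ℝ)⌉₊ + 3 ≤
      8 * (1 + Real.log N) * (1 + Real.log (9 + 8 * Real.log N)) + 3 := by
  have hB0 : (0 : ℝ) < B := by exact_mod_cast hB
  have hH0 : (0 : ℝ) < harmonic B := by exact_mod_cast harmonic_pos (by omega)
  have hH : (harmonic B : ℝ) ≤ 1 + Real.log N :=
    (harmonic_le_one_add_log B).trans
      (by gcongr)
  set M := ⌈(8 * harmonic B : ℝ)⌉₊
  have hM0 : (0 : ℝ) < M := by exact_mod_cast Nat.ceil_pos.2 (by positivity)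
  have hM : (M : ℝ) ≤ 9 + 8 * Real.log N := by
    have := Nat.ceil_lt_add_one (show (0 : ℝ) ≤ 8 * harmonic B by positivity)
    linarith
  have hHM : (harmonic M : ℝ) ≤ 1 + Real.log (9 + 8 * Real.log N) :=
    (harmonic_le_one_add_log M).trans (by gcongr)
  have hHM0 : (0 : ℝ) < harmonic M := by
    exact_mod_cast harmonic_pos (by exact_mod_cast hM0.ne')
  gcongr

/-- The number `e` lies strictly between 2 and 3. This keeps `(log log N) ^ 2` positive for the
small `N`. -/
lemma log_ne_one (N : ℕ) : Real.log N ≠ 1 := by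
  intro h
  have hN : (0 : ℝ) < N := by
    rcases Nat.eq_zero_or_pos N with rfl | h0
    · simp at h
    · exact_mod_cast h0
  have he : (N : ℝ) = Real.exp 1 := by rw [← h, Real.exp_log hN]
  have h1 := Real.exp_one_gt_d9
  have h2 := Real.exp_one_lt_d9
  rw [← he] at h1 h2
  have h3 : (2 : ℝ) < N := by linarith
  have h4 : (N : ℝ) < 3 := by linarith
  norm_cast at h3 h4
  omega

/-- From 16 on `log N > e`, so `log log N ≥ 1` and lower-order terms are absorbed: `83 = 8 * 2 * 5 +
3`. -/
lemma loglog_bound {N : ℕ} (hN : 16 ≤ N) :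
    8 * (1 + Real.log N) * (1 + Real.log (9 + 8 * Real.log N)) + 3 ≤
      83 * (Real.log N * Real.log (Real.log N) ^ 2) := by
  have he := Real.exp_one_lt_d9
  have he0 := Real.exp_pos 1
  have hl : Real.exp 1 ≤ Real.log N := by
    have h2 := Real.log_two_gt_d9
    have h16 : Real.log 16 = 4 * Real.log 2 := by
      rw [show (16 : ℝ) = 2 ^ 4 by norm_num, Real.log_pow]; norm_num
    have : Real.log 16 ≤ Real.log N := Real.log_le_log (by norm_num) (by exact_mod_cast hN)
    linarith
  set l := Real.log N
  have hl1 : 1 ≤ l := by linarith [Real.add_one_le_exp (1 : ℝ)]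
  have hll : 1 ≤ Real.log l := by
    rw [Real.le_log_iff_exp_le (by linarith)]; exact hl
  have h12 : Real.log 12 ≤ 3 := by
    rw [Real.log_le_iff_le_exp (by norm_num)]
    have h3 : Real.exp 3 = Real.exp 1 ^ 3 := by rw [← Real.exp_nat_mul]; norm_num
    have := Real.exp_one_gt_d9
    rw [h3]
    calc (12 : ℝ) ≤ 2.7 ^ 3 := by norm_num
      _ ≤ _ := by gcongr; linarith
  have h1 : Real.log (9 + 8 * l) ≤ 3 + Real.log l := by
    by_cases h : 9 + 8 * l ≤ 12 * l
    · calc Real.log (9 + 8 * l) ≤ Real.log (12 * l) := Real.log_le_log (by linarith) h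
        _ = Real.log 12 + Real.log l := Real.log_mul (by norm_num) (by linarith)
        _ ≤ _ := by linarith
    · linarith [Real.exp_one_gt_d9]
  have h0 : 0 ≤ Real.log (9 + 8 * l) := Real.log_nonneg (by linarith)
  calc 8 * (1 + l) * (1 + Real.log (9 + 8 * l)) + 3
      ≤ 8 * (2 * l) * (5 * Real.log l) + 3 := by gcongr <;> linarith
    _ ≤ 83 * (l * Real.log l) := by nlinarith
    _ ≤ _ := by
      gcongr
      nlinarith

lemma exists_const_bound : ∃ C : ℝ, ∀ N : ℕ, 2 ≤ N →
    8 * (1 + Real.log N) * (1 + Real.log (9 + 8 * Real.log N)) + 3 ≤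
      C * (Real.log N * Real.log (Real.log N) ^ 2) := by
  set g : ℕ → ℝ := fun N ↦ 8 * (1 + Real.log N) * (1 + Real.log (9 + 8 * Real.log N)) + 3 with hg
  set f : ℕ → ℝ := fun N ↦ Real.log N * Real.log (Real.log N) ^ 2 with hf
  have hl : ∀ N : ℕ, 0 ≤ Real.log N := fun N ↦ Real.log_natCast_nonneg N
  have hg0 : ∀ N, 0 ≤ g N := by
    intro N
    have h1 := hl N
    have h2 : 0 ≤ Real.log (9 + 8 * Real.log N) := Real.log_nonneg (by linarith)
    simp only [hg]
    positivity
  have hf0 : ∀ N, 0 ≤ f N := fun N ↦ mul_nonneg (hl N) (sq_nonneg _)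
  have hfpos : ∀ N, 2 ≤ N → 0 < f N := by
    intro N hN
    have h1 : 0 < Real.log N := Real.log_pos (by exact_mod_cast hN)
    have h2 : Real.log (Real.log N) ≠ 0 :=
      Real.log_ne_zero_of_pos_of_ne_one h1 (log_ne_one N)
    exact mul_pos h1 (by positivity)
  have hs : ∀ N, 0 ≤ g N / f N := fun N ↦ div_nonneg (hg0 N) (hf0 N)
  -- The finitely many `N < 16` are covered by adding all their ratios to the constant.
  refine ⟨83 + ∑ n ∈ Finset.range 16, g n / f n, fun N hN ↦ ?_⟩
  show g N ≤ _ * f N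
  rcases lt_or_ge N 16 with h | h
  · have h1 : g N / f N ≤ ∑ n ∈ Finset.range 16, g n / f n :=
      Finset.single_le_sum (f := fun n ↦ g n / f n) (fun n _ ↦ hs n) (Finset.mem_range.2 h)
    rw [← div_le_iff₀ (hfpos N hN)]
    linarith
  · refine (loglog_bound h).trans ?_
    exact mul_le_mul_of_nonneg_right
      (le_add_of_nonneg_right (Finset.sum_nonneg fun n _ ↦ hs n)) (hf0 N)

end Graph

theorem lemma1p13 :
    ∃ C : ℝ, ∀ N A B : ℕ, 1 ≤ B → B ≤ A → A ≤ 2 * B → 2 * B ≤ N →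
      ∃ (α β : Type) (G : Graph α β) (e : β),
        G.vertexSet.Finite ∧ G.edgeSet.Finite ∧ G.IsConnected ∧ G.IsPlanar ∧
        (∃ x y, x ≠ y ∧ G.IsLink e x y) ∧
        (G.edgeSet.ncard : ℝ) ≤ C * (Real.log N * Real.log (Real.log N) ^ 2) ∧
        G.spanningTreeRatio e = (A : ℚ) / (B : ℚ) := by
  obtain ⟨C, hC⟩ := Graph.exists_const_bound
  refine ⟨C, fun N A B hB hBA hA hN ↦ ?_⟩
  obtain ⟨L, L', hval, hlen⟩ := Graph.exists_lists_of_ratio hB hBA hA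
  refine ⟨ℕ, ℕ, Graph.fanOfLists L L', L.length, Set.finite_Iic _, Set.finite_Iio _,
    Graph.isConnected_fan (k := L.length) (by omega) (by simp), Graph.isPlanar_fan,
    Graph.fanOfLists_isLink L L', ?_, by rw [Graph.spanningTreeRatio_fanOfLists, hval]⟩
  have hcard : (Graph.fanOfLists L L').edgeSet.ncard = L.length + 1 + L'.length := by
    show (Set.Iio (L.length + 1 + L'.length)).ncard = _
    rw [← Finset.coe_Iio, Set.ncard_coe_finset, Nat.card_Iio]
  rw [hcard]
  push_cast
  exact hlen.trans ((Graph.harmonic_bound hB (by omega)).trans (hC N (by omega)))
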